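/- For every $\varepsilon>0$ there is $T$ such that for every integer $t\ge T$, every $2$-coloring of the edges of the complete graph on $2^t$ vertices contains at least $2^{(\frac14-\varepsilon)t^2}$ monochromatic complete subgraphs whose sizes (numbers of vertices) $r$ satisfy $0.3t<r<0.7t$. Equivalently, with $\log$ the binary logarithm: for every $\varepsilon>0$ there is $N$ such that for every integer $n\ge N$, every $2$-coloring of the edges of the complete graph on $n$ vertices contains at least $n^{(\frac14-\varepsilon)\log n}$ monochromatic complete subgraphs whose sizes $r$ satisfy $0.3\log n<r<0.7\log n$. (Different subgraphs in these counts may have different sizes.) -/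

import Mathlib

/-- A set `s` of vertices spans a monochromatic complete subgraph of the `2`-coloring `C` of the
edges of the complete graph on `V`: all edges inside `s` have the same color. -/
def IsMonoClique {V : Type*} (C : SimpleGraph.TopEdgeLabeling V (Fin 2)) (s : Finset V) : Prop :=
  ∃ c : Fin 2, (C.labelGraph c).IsClique (s : Set V)

/-- The number of monochromatic complete subgraphs of `C` whose size `r` (number of vertices)
satisfies `a < r < b`. Each subgraph is counted once, through its set of vertices. -/
noncomputable def monoCliqueCount {V : Type*} (C : SimpleGraph.TopEdgeLabeling V (Fin 2))
    (a b : ℝ) : ℕ :=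
  Set.ncard {s : Finset V | IsMonoClique C s ∧ a < (s.card : ℝ) ∧ (s.card : ℝ) < b}

/-!
A clique is found by exposing vertices one at a time: a vertex of the current vertex set is chosen,
and the set shrinks to the red or to the blue neighbors of the vertex. In the end the red steps have
collected a red clique, the blue steps a blue one. If `2 ^ s` bounds the current set from below,
there are `2 ^ s` choices at that step. Let `x` be the sum of the values `s` over the red steps
and `y` the sum over the blue steps. Choosing the vertices at random, one sees that some color
pattern yields at least about `2 ^ x` ordered red cliques and at the same time at least about
`2 ^ y` ordered blue cliques (`Forces.exists_outcome`); the number of patterns and of orderings is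
`2 ^ o(t ^ 2)`. So it remains to play well a game against an opponent who chooses the colors.

Following the majority color costs `1` of the `t` units of `s` per step, so that `x + y` is about
`t ^ 2 / 2`, and one of `x` and `y` is at least `t ^ 2 / 4`. The color with the larger weight may
have more than `0.7 t` vertices, though, and lose too much weight if its clique is cut down to
`0.7 t` vertices; this needs a pattern close to `0.293 t` blue steps followed by red ones. Therefore
the strategy bisects only for the first `t / 4` steps. If each color has by then `0.07 t` vertices,
the pattern is far enough from the critical one, and bisection goes on (`forces_bisection`).
Otherwise say that almost all steps were blue. Then blue gets preference: a blue step shrinks the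
set by the factor `2 ^ (-1.1)`, but a red one only by `2 ^ (-0.91)` (`forces_biased`). If blue still
does not reach `0.3 t` vertices, the cheap red steps give more red weight than needed. If it does,
the preference has cost little, since blue has most of its weight from the beginning.
-/

open Finset

/-! ### Counting cliques -/

/-- The number of cliques of `G` with `k` vertices, all of them in `A`, each counted with its `k !`
orderings. -/
noncomputable def orderedCliques {V : Type*} (G : SimpleGraph V) (A : Finset V) (k : ℕ) : ℕ :=
  open Classical in k.factorial * #((A.powersetCard k).filter fun K : Finset V => G.IsClique (K : Set V))

/-- The neighbors of `v` in `A`. -/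
noncomputable def nbrs {V : Type*} (G : SimpleGraph V) (A : Finset V) (v : V) : Finset V :=
  open Classical in {w ∈ A | G.Adj v w}

section Cliques

variable {V : Type*} (G H : SimpleGraph V)

theorem orderedCliques_zero (A : Finset V) : orderedCliques G A 0 = 1 := by
  classical
  simp [orderedCliques, Finset.filter_singleton]

theorem nbrs_subset (A : Finset V) (v : V) : nbrs G A v ⊆ A := by
  classical
  exact Finset.filter_subset _ _

theorem orderedCliques_mono {A B : Finset V} (h : A ⊆ B) (k : ℕ) :
    orderedCliques G A k ≤ orderedCliques G B k := by
  classical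
  unfold orderedCliques
  gcongr
  exact powersetCard_mono h

/-- Each ordered clique with `k + 1` vertices is determined by its first vertex `v` and an ordered
clique with `k` vertices among the neighbors of `v`. -/
theorem sum_orderedCliques_nbrs_le (A : Finset V) (k : ℕ) :
    ∑ v ∈ A, orderedCliques G (nbrs G A v) k ≤ orderedCliques G A (k + 1) := by
  classical
  unfold orderedCliques
  rw [← Finset.mul_sum, Nat.factorial_succ, mul_comm (k + 1), mul_assoc]
  gcongr
  rw [← Finset.card_sigma]
  have hsum : (k + 1) * #((A.powersetCard (k + 1)).filter fun K : Finset V => G.IsClique (K : Set V))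
      = #(((A.powersetCard (k + 1)).filter fun K : Finset V => G.IsClique (K : Set V)).sigma
          fun K => K) := by
    rw [Finset.card_sigma, Finset.sum_congr rfl (g := fun _ => k + 1), Finset.sum_const,
      smul_eq_mul, mul_comm]
    intro K hK
    simp only [mem_filter, mem_powersetCard] at hK
    exact hK.1.2
  rw [hsum]
  refine Finset.card_le_card_of_injOn (fun p => ⟨insert p.1 p.2, p.1⟩) ?_ ?_
  · rintro ⟨v, K⟩ h
    simp only [coe_sigma, Set.mem_sigma_iff, mem_coe, mem_filter, mem_powersetCard, nbrs] at h ⊢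
    obtain ⟨hv, ⟨hK, hc⟩, hq⟩ := h
    have hvK : v ∉ K := fun hm => G.loopless.irrefl v (mem_filter.1 (hK hm)).2
    refine ⟨⟨⟨?_, ?_⟩, ?_⟩, mem_insert_self _ _⟩
    · exact insert_subset hv (hK.trans (filter_subset _ _))
    · rw [card_insert_of_notMem hvK, hc]
    · rw [coe_insert]
      exact hq.insert fun w hw _ => (mem_filter.1 (hK hw)).2
  · rintro ⟨v, K⟩ h ⟨v', K'⟩ h' he
    simp only [coe_sigma, Set.mem_sigma_iff, mem_coe, mem_filter, mem_powersetCard, nbrs] at h h'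
    have hvK : v ∉ K := fun hm => G.loopless.irrefl v (mem_filter.1 (h.2.1.1 hm)).2
    have hvK' : v' ∉ K' := fun hm => G.loopless.irrefl v' (mem_filter.1 (h'.2.1.1 hm)).2
    simp only [Sigma.mk.injEq, heq_eq_eq] at he
    obtain ⟨he, rfl⟩ := he
    have : K = K' := by rw [← erase_insert hvK, he, erase_insert hvK']
    rw [this]

variable {G H} in
theorem card_le_card_nbrs_add (hGH : ∀ v w, v ≠ w → G.Adj v w ∨ H.Adj v w) (A : Finset V) (v : V) :
    #A ≤ #(nbrs G A v) + #(nbrs H A v) + 1 := by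
  classical
  have : A ⊆ insert v (nbrs G A v ∪ nbrs H A v) := by
    intro w hw
    by_cases h : v = w
    · simp [h]
    · rcases hGH v w h with h | h <;> simp [nbrs, hw, h]
  calc #A ≤ _ := card_le_card this
    _ ≤ _ := card_insert_le _ _
    _ ≤ _ := by gcongr; exact card_union_le _ _

end Cliques

/-! ### The exposure game -/

/-- A set of at least `2 ^ s` vertices can always be passed on to a set of `2 ^ s₀` red neighbors or
to a set of `2 ^ s₁` blue neighbors of any of its vertices: `m` and `n` are the red and blue degrees
inside the set, which has `m + n + 1` vertices at most. -/
def Splits (s s₀ s₁ : ℝ) : Prop :=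
  ∀ m n : ℕ, (2 : ℝ) ^ s ≤ m + n + 1 → (2 : ℝ) ^ s₀ ≤ m ∨ (2 : ℝ) ^ s₁ ≤ n

/-- `Forces Q m s r b x y` says that the exposure game, from the given state, can be played so that
it ends, after at most `m` further steps, in a state with `Q`. In a state, `2 ^ s` bounds the size
of the current vertex set from below, `r` and `b` count the red and the blue steps made so far, and
`x` and `y` add up the values of `s` before the red and before the blue steps. A step exposes a
vertex of the current set and passes to its red or its blue neighbors; the player chooses the bounds
`s₀` and `s₁` on the new sizes, and has to be ready for both colors. -/
inductive Forces (Q : ℕ → ℕ → ℝ → ℝ → Prop) : ℕ → ℝ → ℕ → ℕ → ℝ → ℝ → Prop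
  | done {m : ℕ} {s : ℝ} {r b : ℕ} {x y : ℝ} (h : Q r b x y) : Forces Q m s r b x y
  | step {m : ℕ} {s s₀ s₁ : ℝ} {r b : ℕ} {x y : ℝ} (h : Splits s s₀ s₁)
      (h₀ : Forces Q m s₀ (r + 1) b (x + s) y) (h₁ : Forces Q m s₁ r (b + 1) x (y + s)) :
      Forces Q (m + 1) s r b x y

theorem Splits.swap {s s₀ s₁ : ℝ} (h : Splits s s₀ s₁) : Splits s s₁ s₀ := fun m n hmn =>
  (h n m (by linarith)).symm

theorem Forces.swap {Q : ℕ → ℕ → ℝ → ℝ → Prop} {m : ℕ} {s : ℝ} {r b : ℕ} {x y : ℝ}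
    (h : Forces Q m s r b x y) : Forces (fun r b x y => Q b r y x) m s b r y x := by
  induction h with
  | done h => exact .done h
  | step h _ _ ih₀ ih₁ => exact .step h.swap ih₁ ih₀

/-- How well `A` meets the count of cliques promised by an outcome `(r, b, x, y)` of the game: the
smaller of the ratios for the two colors. -/
noncomputable def score {V : Type*} (G H : SimpleGraph V) (A : Finset V) (p : ℕ × ℕ × ℝ × ℝ) : ℝ :=
  min (orderedCliques G A p.1 * (2 : ℝ) ^ (-p.2.2.1))
    (orderedCliques H A p.2.1 * (2 : ℝ) ^ (-p.2.2.2))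

section Game

variable {V : Type*} {G H : SimpleGraph V}

theorem score_swap (A : Finset V) (r b : ℕ) (x y : ℝ) :
    score G H A (r, b, x, y) = score H G A (b, r, y, x) := min_comm _ _

theorem sum_score_le {A S : Finset V} {s : ℝ} (hs : (2 : ℝ) ^ s ≤ #A) (hS : S ⊆ A)
    (p : ℕ × ℕ × ℝ × ℝ) :
    ∑ v ∈ S, score G H (nbrs G A v) p
      ≤ #A * score G H A (p.1 + 1, p.2.1, p.2.2.1 + s, p.2.2.2) := by
  have hA : (0 : ℝ) < #A := lt_of_lt_of_le (by positivity) hs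
  unfold score
  rw [mul_min_of_nonneg _ _ hA.le]
  refine le_min ?_ ?_
  · calc _ ≤ ∑ v ∈ S, orderedCliques G (nbrs G A v) p.1 * (2 : ℝ) ^ (-p.2.2.1) :=
          sum_le_sum fun v _ => min_le_left _ _
      _ ≤ ∑ v ∈ A, orderedCliques G (nbrs G A v) p.1 * (2 : ℝ) ^ (-p.2.2.1) :=
          sum_le_sum_of_subset_of_nonneg hS fun _ _ _ => by positivity
      _ = ((∑ v ∈ A, orderedCliques G (nbrs G A v) p.1 : ℕ) : ℝ) * (2 : ℝ) ^ (-p.2.2.1) := by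
          rw [← sum_mul]; push_cast; rfl
      _ ≤ orderedCliques G A (p.1 + 1) * (2 : ℝ) ^ (-p.2.2.1) := by
          gcongr; exact sum_orderedCliques_nbrs_le G A _
      _ = 2 ^ s * (orderedCliques G A (p.1 + 1) * (2 : ℝ) ^ (-(p.2.2.1 + s))) := by
          rw [neg_add, Real.rpow_add two_pos, Real.rpow_neg two_pos.le s]
          field_simp
      _ ≤ _ := by gcongr
  · calc _ ≤ ∑ v ∈ S, orderedCliques H (nbrs G A v) p.2.1 * (2 : ℝ) ^ (-p.2.2.2) :=
          sum_le_sum fun v _ => min_le_right _ _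
      _ ≤ ∑ v ∈ S, orderedCliques H A p.2.1 * (2 : ℝ) ^ (-p.2.2.2) := by
          gcongr with v; exact orderedCliques_mono H (nbrs_subset G A v) _
      _ = #S * (orderedCliques H A p.2.1 * (2 : ℝ) ^ (-p.2.2.2)) := by
          rw [sum_const, nsmul_eq_mul]
      _ ≤ _ := by gcongr

/-- The first vertex of the game: if the neighborhoods of the vertices in `S` have total score at
least `1` over the outcomes in `D`, then `A` has total score at least `#S / #A` over the same
outcomes with one more red step. -/
theorem card_le_sum_score {A S : Finset V} {s : ℝ} (hs : (2 : ℝ) ^ s ≤ #A) (hS : S ⊆ A)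
    (D : Multiset (ℕ × ℕ × ℝ × ℝ))
    (hD : ∀ v ∈ S, 1 ≤ (D.map (score G H (nbrs G A v))).sum) :
    (#S : ℝ) ≤ #A *
      (D.map fun p => score G H A (p.1 + 1, p.2.1, p.2.2.1 + s, p.2.2.2)).sum := by
  have hswap : ∑ v ∈ S, (D.map (score G H (nbrs G A v))).sum
      = (D.map fun p => ∑ v ∈ S, score G H (nbrs G A v) p).sum := by
    clear hD
    induction D using Multiset.induction with
    | empty => simp
    | cons a D ih => simp [sum_add_distrib, ih]
  calc (#S : ℝ) = ∑ v ∈ S, (1 : ℝ) := by simp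
    _ ≤ ∑ v ∈ S, (D.map (score G H (nbrs G A v))).sum := sum_le_sum hD
    _ = _ := hswap
    _ ≤ (D.map fun p => #A * score G H A (p.1 + 1, p.2.1, p.2.2.1 + s, p.2.2.2)).sum :=
        Multiset.sum_map_le_sum_map _ _ fun p _ => sum_score_le hs hS p
    _ = _ := Multiset.sum_map_mul_left

theorem Forces.exists_multiset (hGH : ∀ v w, v ≠ w → G.Adj v w ∨ H.Adj v w)
    {Q : ℕ → ℕ → ℝ → ℝ → Prop} {m : ℕ} {s : ℝ} {r b : ℕ} {x y : ℝ} (h : Forces Q m s r b x y) :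
    ∃ D : Multiset (ℕ × ℕ × ℝ × ℝ), D.card ≤ 2 ^ m ∧
      (∀ p ∈ D, Q (r + p.1) (b + p.2.1) (x + p.2.2.1) (y + p.2.2.2)) ∧
      ∀ A : Finset V, (2 : ℝ) ^ s ≤ #A → 1 ≤ (D.map (score G H A)).sum := by
  classical
  induction h with
  | done h =>
    refine ⟨{(0, 0, 0, 0)}, ?_, ?_, ?_⟩
    · simpa using Nat.one_le_two_pow
    · simpa using h
    · intro A _
      simp [score, orderedCliques_zero]
  | @step m s s₀ s₁ r b x y hsp h₀ h₁ ih₀ ih₁ =>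
    obtain ⟨D₀, hc₀, hQ₀, hD₀⟩ := ih₀
    obtain ⟨D₁, hc₁, hQ₁, hD₁⟩ := ih₁
    refine ⟨D₀.map (fun p => (p.1 + 1, p.2.1, p.2.2.1 + s, p.2.2.2))
      + D₁.map (fun p => (p.1, p.2.1 + 1, p.2.2.1, p.2.2.2 + s)), ?_, ?_, ?_⟩
    · simp only [Multiset.card_add, Multiset.card_map, pow_succ]
      omega
    · intro p hp
      rcases Multiset.mem_add.1 hp with hp | hp
      · obtain ⟨q, hq, rfl⟩ := Multiset.mem_map.1 hp
        convert hQ₀ q hq using 1 <;> simp only <;> ring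
      · obtain ⟨q, hq, rfl⟩ := Multiset.mem_map.1 hp
        convert hQ₁ q hq using 1 <;> simp only <;> ring
    · intro A hA
      have hA0 : (0 : ℝ) < #A := lt_of_lt_of_le (by positivity) hA
      set S : Finset V := {v ∈ A | (2 : ℝ) ^ s₀ ≤ #(nbrs G A v)} with hSdef
      have hS : S ⊆ A := filter_subset _ _
      have e₀ := card_le_sum_score (G := G) (H := H) hA hS D₀ fun v hv =>
        hD₀ _ (mem_filter.1 hv).2
      have e₁ := card_le_sum_score (G := H) (H := G) hA (sdiff_subset (s := A) (t := S))
        (D₁.map fun p => (p.2.1, p.1, p.2.2.2, p.2.2.1)) (by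
          intro v hv
          rw [mem_sdiff] at hv
          have hcard : (2 : ℝ) ^ s ≤ #(nbrs G A v) + #(nbrs H A v) + 1 :=
            hA.trans (by exact_mod_cast card_le_card_nbrs_add hGH A v)
          rcases hsp _ _ hcard with h | h
          · exact absurd (mem_filter.2 ⟨hv.1, h⟩) hv.2
          · have := hD₁ _ h
            rw [Multiset.map_map]
            simpa only [Function.comp_def, ← score_swap] using this)
      rw [Multiset.map_map] at e₁
      simp only [Function.comp_def, ← score_swap] at e₁
      rw [Multiset.map_add, Multiset.sum_add, Multiset.map_map, Multiset.map_map]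
      simp only [Function.comp_def]
      have hcard : (#S : ℝ) + #(A \ S) = #A := by
        rw [← Nat.cast_add, add_comm, card_sdiff_add_card_eq_card hS]
      refine le_of_mul_le_mul_left ?_ hA0
      linarith

/-- The outcome of the game is realized, for both colors at once, up to the factor `2 ^ m` for the
number of possible color patterns. -/
theorem Forces.exists_outcome (hGH : ∀ v w, v ≠ w → G.Adj v w ∨ H.Adj v w)
    {Q : ℕ → ℕ → ℝ → ℝ → Prop} {m : ℕ} {s : ℝ} (h : Forces Q m s 0 0 0 0)
    {A : Finset V} (hA : (2 : ℝ) ^ s ≤ #A) :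
    ∃ r b x y, Q r b x y ∧ (2 : ℝ) ^ (x - m) ≤ orderedCliques G A r ∧
      (2 : ℝ) ^ (y - m) ≤ orderedCliques H A b := by
  obtain ⟨D, hc, hQ, hD⟩ := h.exists_multiset hGH
  have hex : ∃ p ∈ D, (2 : ℝ) ^ (-(m : ℝ)) ≤ score G H A p := by
    by_contra! hlt
    have hne : D ≠ 0 := by
      rintro rfl
      have := hD A hA
      norm_num at this
    have h1 : (D.map (score G H A)).sum < (D.map fun _ => (2 : ℝ) ^ (-(m : ℝ))).sum :=
      Multiset.sum_lt_sum_of_nonempty hne hlt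
    have h2 : (D.map fun _ => (2 : ℝ) ^ (-(m : ℝ))).sum ≤ 1 := by
      rw [Multiset.map_const', Multiset.sum_replicate, nsmul_eq_mul, Real.rpow_neg two_pos.le,
        Real.rpow_natCast, ← div_eq_mul_inv, div_le_one (by positivity)]
      exact_mod_cast hc
    linarith [hD A hA]
  obtain ⟨p, hp, hlow⟩ := hex
  refine ⟨p.1, p.2.1, p.2.2.1, p.2.2.2, by simpa using hQ p hp, ?_, ?_⟩
  · have := hlow.trans (min_le_left _ _)
    rw [Real.rpow_neg two_pos.le p.2.2.1, ← div_eq_mul_inv, le_div_iff₀ (by positivity),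
      ← Real.rpow_add two_pos] at this
    rwa [sub_eq_add_neg, add_comm]
  · have := hlow.trans (min_le_right _ _)
    rw [Real.rpow_neg two_pos.le p.2.2.2, ← div_eq_mul_inv, le_div_iff₀ (by positivity),
      ← Real.rpow_add two_pos] at this
    rwa [sub_eq_add_neg, add_comm]

end Game

/-! ### Playing the game from `2 ^ t` vertices -/

theorem splits_bisect (k : ℕ) : Splits (k + 1 : ℕ) k k := by
  intro m n h
  rw [Real.rpow_natCast] at h ⊢
  have h' : 2 ^ (k + 1) ≤ m + n + 1 := by exact_mod_cast h
  have : 2 ^ k ≤ m ∨ 2 ^ k ≤ n := by rw [pow_succ] at h'; omega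
  exact_mod_cast this

/-- The biased split: `2 ^ (-0.91) + 2 ^ (-1.1) < 1`, with some room for the exposed vertex. -/
theorem splits_biased {s : ℝ} (hs : 20 ≤ s) : Splits s (s - 91 / 100) (s - 11 / 10) := by
  have h₀ : (2 : ℝ) ^ (-(91 / 100) : ℝ) ≤ 5323 / 10000 := by
    refine le_of_pow_le_pow_left₀ (n := 100) (by norm_num) (by norm_num) ?_
    rw [← Real.rpow_natCast, ← Real.rpow_mul two_pos.le]
    norm_num
  have h₁ : (2 : ℝ) ^ (-(11 / 10) : ℝ) ≤ 4666 / 10000 := by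
    refine le_of_pow_le_pow_left₀ (n := 10) (by norm_num) (by norm_num) ?_
    rw [← Real.rpow_natCast, ← Real.rpow_mul two_pos.le]
    norm_num
  have hbig : (2 : ℝ) ^ (20 : ℝ) ≤ 2 ^ s := Real.rpow_le_rpow_of_exponent_le one_le_two hs
  norm_num at hbig
  intro m n h
  by_contra! hlt
  rw [sub_eq_add_neg, sub_eq_add_neg, Real.rpow_add two_pos, Real.rpow_add two_pos] at hlt
  nlinarith [hlt.1, hlt.2]

/-- The outcomes to aim for: one of the colors has between `0.3 t + 1` and `0.7 t` vertices and
weight at least `t ^ 2 / 4 - t`. -/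
def Good (t : ℝ) (r b : ℕ) (x y : ℝ) : Prop :=
  (3 / 10 * t + 1 < r ∧ (r : ℝ) < 7 / 10 * t ∧ t ^ 2 / 4 - t ≤ x) ∨
    (3 / 10 * t + 1 < b ∧ (b : ℝ) < 7 / 10 * t ∧ t ^ 2 / 4 - t ≤ y)

theorem good_comm {t : ℝ} {r b : ℕ} {x y : ℝ} : Good t r b x y ↔ Good t b r y x := or_comm

/-- Bisection stopped with `0.7 t` red vertices. The bound `hx` reflects that the `i`-th red vertex
comes after at most `i + b` others, and that the first `0.07 t` red vertices precede all but
`0.18 t + 1` of the blue ones. -/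
theorem good_of_bisection {t s x y : ℝ} {r b : ℕ} (ht : 100000 ≤ t) (hs : s = t - r - b)
    (hs0 : 0 ≤ s) (hr0 : 7 / 10 * t - 2 ≤ r) (hr : (r : ℝ) < 7 / 10 * t - 1)
    (hb : (b : ℝ) < 7 / 10 * t - 1) (hxy : (t ^ 2 - s ^ 2) / 2 ≤ x + y)
    (hx : r * (t - b) - r ^ 2 / 2 + 7 / 100 * t * (b - 18 / 100 * t - 1) ≤ x) :
    Good t r b x y := by
  by_cases hb3 : 3 / 10 * t + 1 < b
  · have h1 : s ≤ 1 := by linarith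
    have h2 : s ^ 2 ≤ 1 := by nlinarith
    by_cases h : t ^ 2 / 4 - t ≤ x
    · exact Or.inl ⟨by linarith, by linarith, h⟩
    · exact Or.inr ⟨hb3, hb.trans_le (by linarith), by linarith⟩
  · push Not at hb3
    refine Or.inl ⟨by linarith, by linarith, ?_⟩
    have h1 : 0 ≤ (r - 7 / 100 * t) * (3 / 10 * t + 1 - b) :=
      mul_nonneg (by linarith) (by linarith)
    have h2 : (r - 7 / 10 * t + 1) ^ 2 ≤ 1 := by nlinarith
    nlinarith

/-- Bisection as a second phase, when both colors have `0.07 t` vertices already: the size `k` drops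
by `1` with each step. -/
theorem forces_bisection {t : ℕ} (ht : 100000 ≤ t) (k : ℕ) : ∀ (m r b : ℕ) (x y : ℝ), k ≤ m →
    r + b + k = t → 7 / 100 * (t : ℝ) ≤ r → (r : ℝ) < 7 / 10 * t - 1 →
    7 / 100 * (t : ℝ) ≤ b → (b : ℝ) < 7 / 10 * t - 1 →
    ((t : ℝ) ^ 2 - (k : ℝ) ^ 2) / 2 ≤ x + y →
    r * ((t : ℝ) - b) - (r : ℝ) ^ 2 / 2 + 7 / 100 * t * (b - 18 / 100 * t - 1) ≤ x →
    b * ((t : ℝ) - r) - (b : ℝ) ^ 2 / 2 + 7 / 100 * t * (r - 18 / 100 * t - 1) ≤ y →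
    Forces (Good t) m k r b x y := by
  have ht' : (100000 : ℝ) ≤ t := by exact_mod_cast ht
  induction k with
  | zero =>
    intro m r b x y _ hk _ hr _ hb hxy hx hy
    have hk' : (r : ℝ) + b = t := by exact_mod_cast hk
    refine .done ?_
    push_cast at hxy
    by_cases h : (t : ℝ) ^ 2 / 4 - t ≤ x
    · exact Or.inl ⟨by linarith, by linarith, h⟩
    · exact Or.inr ⟨by linarith, by linarith, by linarith⟩
  | succ k ih =>
    intro m r b x y hm hk hr0 hr hb0 hb hxy hx hy
    have hk' : (r : ℝ) + b + (k + 1 : ℕ) = t := by exact_mod_cast hk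
    have hk0 : (0 : ℝ) ≤ (k + 1 : ℕ) := Nat.cast_nonneg _
    by_cases hr1 : 7 / 10 * (t : ℝ) - 2 ≤ r
    · exact .done (good_of_bisection ht' (by linarith) hk0 hr1 hr hb hxy hx)
    by_cases hb1 : 7 / 10 * (t : ℝ) - 2 ≤ b
    · exact .done (good_comm.1
        (good_of_bisection ht' (by linarith) hk0 hb1 hb hr (by linarith) hy))
    push Not at hr1 hb1
    obtain ⟨m, rfl⟩ : ∃ m', m = m' + 1 := ⟨m - 1, by omega⟩
    push_cast at hk' hxy
    refine .step (splits_bisect k) (ih _ _ _ _ _ ?_ ?_ ?_ ?_ ?_ ?_ ?_ ?_ ?_)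
      (ih _ _ _ _ _ ?_ ?_ ?_ ?_ ?_ ?_ ?_ ?_ ?_) <;> first | omega | skip
    all_goals push_cast
    all_goals nlinarith

/-- The outcome of the biased game, started with `r₁` red and `b₁` blue vertices, where `r₁` is
small, and played for `p` red and `q` blue steps until one color has `0.7 t` vertices or the vertex
set is used up. -/
theorem good_of_biased {t s₁ s x₁ y₁ u v : ℝ} {r₁ b₁ p q : ℕ} (ht : 100000 ≤ t)
    (hs₁ : s₁ = t - r₁ - b₁) (hlow : t / 4 ≤ r₁ + b₁) (hupp : (r₁ : ℝ) + b₁ < t / 4 + 1)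
    (hr₁ : (r₁ : ℝ) < 7 / 100 * t) (hxy₁ : (t ^ 2 - s₁ ^ 2) / 2 ≤ x₁ + y₁)
    (hx₁ : r₁ * (t - b₁) - (r₁ : ℝ) ^ 2 / 2 ≤ x₁) (hy₁ : b₁ * (t - r₁) - (b₁ : ℝ) ^ 2 / 2 ≤ y₁)
    (hs : s = s₁ - 91 / 100 * p - 11 / 10 * q) (hs18 : 18 ≤ s)
    (hr : (r₁ : ℝ) + p < 7 / 10 * t - 1) (hb : (b₁ : ℝ) + q < 7 / 10 * t - 1)
    (huv : (s₁ ^ 2 - s ^ 2) / 2 ≤ 91 / 100 * u + 11 / 10 * v)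
    (hu : p * (s₁ - 11 / 10 * q) - 91 / 200 * (p : ℝ) ^ 2 ≤ u)
    (hv : q * (s₁ - 91 / 100 * p) - 11 / 20 * (q : ℝ) ^ 2 ≤ v)
    (hend : 7 / 10 * t - 2 ≤ r₁ + p ∨ 7 / 10 * t - 2 ≤ b₁ + q ∨ s < 20) :
    Good t (r₁ + p) (b₁ + q) (x₁ + u) (y₁ + v) := by
  have hr₁0 : (0 : ℝ) ≤ r₁ := Nat.cast_nonneg _
  have hp0 : (0 : ℝ) ≤ p := Nat.cast_nonneg _
  have hq0 : (0 : ℝ) ≤ q := Nat.cast_nonneg _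
  unfold Good
  push_cast
  -- The blue vertices of the first phase were chosen from sets of size at least `2 ^ s₁`.
  have ht2 : 0 ≤ t * (t - 100000) := mul_nonneg (by linarith only [ht]) (by linarith only [ht])
  have hy₁' : 1512 / 10000 * t ^ 2 - t ≤ y₁ := by
    have h1 : 0 ≤ (b₁ - 18 / 100 * t) * (t - r₁ - b₁ / 2) :=
      mul_nonneg (by linarith only [hlow, hr₁]) (by linarith only [hupp, hr₁0, hr₁, ht])
    have h2 : 0 ≤ t * (t - r₁ - b₁ / 2 - (84 / 100 * t - 1 / 2)) :=
      mul_nonneg (by linarith only [ht]) (by linarith only [hupp, hr₁])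
    linarith only [h1, h2, hy₁, ht]
  by_cases hb3 : 3 / 10 * t + 1 < b₁ + q
  · by_cases hr3 : 3 / 10 * t + 1 < r₁ + p
    · -- Both sizes are admissible, and the two weights have a large sum.
      have hs6 : s ≤ 6 / 100 * t := by
        rcases hend with h | h | h <;> linarith only [h, hs, hs₁, hupp, hb3, hr3, ht, hr₁0]
      have h1 : s ^ 2 ≤ (6 / 100 * t) ^ 2 := pow_le_pow_left₀ (by linarith only [hs18]) hs6 2
      have h2 : (3 / 4 * t - 1) ^ 2 ≤ s₁ ^ 2 :=
        pow_le_pow_left₀ (by linarith only [ht]) (by linarith only [hs₁, hupp]) 2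
      by_cases h : t ^ 2 / 4 - t ≤ x₁ + u
      · exact Or.inl ⟨hr3, by linarith only [hr], h⟩
      · refine Or.inr ⟨hb3, by linarith only [hb], ?_⟩
        linarith only [h, huv, hxy₁, hy₁', h1, h2, ht2, ht]
    · -- With few red vertices there are many blue ones in the second phase.
      push Not at hr3
      refine Or.inr ⟨hb3, by linarith only [hb], ?_⟩
      have hq : 433 / 1000 * t - 22 ≤ q := by
        rcases hend with h | h | h <;>
          linarith only [h, hs, hs₁, hlow, hupp, hr3, hr₁0, ht]
      have h1 : (433 / 1000 * t - 22) ^ 2 ≤ (q : ℝ) ^ 2 :=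
        pow_le_pow_left₀ (by linarith only [ht]) hq 2
      have h2 : 0 ≤ q * (s₁ - 91 / 100 * p - 11 / 10 * q) :=
        mul_nonneg hq0 (by linarith only [hs, hs18])
      linarith only [h1, h2, hv, hy₁', ht2, ht]
  · -- With few blue vertices the cheap red steps give much red weight.
    push Not at hb3
    have hr7 : 7 / 10 * t - 2 ≤ r₁ + p := by
      rcases hend with h | h | h
      · exact h
      · linarith only [h, hb3, ht]
      · linarith only [h, hs, hs₁, hupp, hlow, hb3, hr, hr₁, ht]
    refine Or.inl ⟨by linarith only [hr7, ht], by linarith only [hr], ?_⟩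
    have h1 : 0 ≤ (p - (7 / 10 * t - 2 - r₁)) * (s₁ - 11 / 10 * q - 91 / 200 * p) :=
      mul_nonneg (by linarith only [hr7]) (by linarith only [hs, hs18, hp0])
    have h2 : 0 ≤ (7 / 10 * t - 2 - r₁) * (s₁ - 11 / 10 * q - 91 / 200 * p
        - (3765 / 10000 * t - 3 - 645 / 1000 * r₁)) :=
      mul_nonneg (by linarith only [hr₁, ht])
        (by linarith only [hs₁, hupp, hb3, hlow, hr, ht])
    have h3 : 0 ≤ r₁ * (t - r₁ - b₁ - (3 / 4 * t - 1)) := mul_nonneg hr₁0 (by linarith only [hupp])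
    have h4 : 0 ≤ t * (7 / 100 * t - r₁) :=
      mul_nonneg (by linarith only [ht]) (by linarith only [hr₁])
    have h6 : 0 ≤ (r₁ : ℝ) ^ 2 := sq_nonneg _
    linarith only [h1, h2, h3, h4, ht2, h6, hu, hx₁, hr₁0, ht]

/-- The second phase when blue dominates the first. The size `s` drops by `0.91` with each of the `p`
red and by `1.1` with each of the `q` blue steps; the bound for `91 / 100 * u + 11 / 10 * v` is the
area under `s`, and those for `u` and `v` are attained when the other color comes first. -/
theorem forces_biased {t : ℕ} {s₁ x₁ y₁ : ℝ} {r₁ b₁ : ℕ} (ht : 100000 ≤ t)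
    (hs₁ : s₁ = t - r₁ - b₁) (hlow : (t : ℝ) / 4 ≤ r₁ + b₁) (hupp : (r₁ : ℝ) + b₁ < t / 4 + 1)
    (hr₁ : (r₁ : ℝ) < 7 / 100 * t) (hxy₁ : ((t : ℝ) ^ 2 - s₁ ^ 2) / 2 ≤ x₁ + y₁)
    (hx₁ : r₁ * ((t : ℝ) - b₁) - (r₁ : ℝ) ^ 2 / 2 ≤ x₁)
    (hy₁ : b₁ * ((t : ℝ) - r₁) - (b₁ : ℝ) ^ 2 / 2 ≤ y₁) (m : ℕ) :
    ∀ (s : ℝ) (p q : ℕ) (u v : ℝ), s ≤ 91 / 100 * m + 19 →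
    s = s₁ - 91 / 100 * p - 11 / 10 * q → 18 ≤ s →
    (r₁ : ℝ) + p < 7 / 10 * t - 1 → (b₁ : ℝ) + q < 7 / 10 * t - 1 →
    (s₁ ^ 2 - s ^ 2) / 2 ≤ 91 / 100 * u + 11 / 10 * v →
    p * (s₁ - 11 / 10 * q) - 91 / 200 * (p : ℝ) ^ 2 ≤ u →
    q * (s₁ - 91 / 100 * p) - 11 / 20 * (q : ℝ) ^ 2 ≤ v →
    Forces (Good t) m s (r₁ + p) (b₁ + q) (x₁ + u) (y₁ + v) := by
  have ht' : (100000 : ℝ) ≤ t := by exact_mod_cast ht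
  induction m with
  | zero =>
    intro s p q u v hm hs hs18 hr hb huv hu hv
    push_cast at hm
    exact .done (good_of_biased ht' hs₁ hlow hupp hr₁ hxy₁ hx₁ hy₁ hs hs18 hr hb huv hu hv
      (Or.inr (Or.inr (by linarith))))
  | succ m ih =>
    intro s p q u v hm hs hs18 hr hb huv hu hv
    by_cases hend : 7 / 10 * (t : ℝ) - 2 ≤ r₁ + p ∨ 7 / 10 * (t : ℝ) - 2 ≤ b₁ + q ∨ s < 20
    · exact .done (good_of_biased ht' hs₁ hlow hupp hr₁ hxy₁ hx₁ hy₁ hs hs18 hr hb huv hu hv hend)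
    push Not at hend
    push_cast at hm
    obtain ⟨hr1, hb1, hs20⟩ := hend
    have hp0 : (0 : ℝ) ≤ p := Nat.cast_nonneg _
    have hq0 : (0 : ℝ) ≤ q := Nat.cast_nonneg _
    subst hs
    refine .step (splits_biased hs20) ?_ ?_
    · rw [add_assoc, add_assoc]
      refine ih _ _ _ _ _ ?_ ?_ ?_ ?_ ?_ ?_ ?_ ?_
      all_goals push_cast
      all_goals linarith
    · rw [add_assoc, add_assoc]
      refine ih _ _ _ _ _ ?_ ?_ ?_ ?_ ?_ ?_ ?_ ?_
      all_goals push_cast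
      all_goals linarith

/-- The first phase bisects until a quarter of the vertices are exposed, with `j` steps to go. -/
theorem forces_first_phase {t t₁ : ℕ} (ht : 100000 ≤ t) (hlow : t ≤ 4 * t₁) (hupp : 4 * t₁ < t + 4)
    (j : ℕ) : ∀ (m r b : ℕ) (x y : ℝ), t + j ≤ m → r + b + j = t₁ →
    ((t : ℝ) ^ 2 - ((t - (r + b) : ℕ) : ℝ) ^ 2) / 2 ≤ x + y →
    r * ((t : ℝ) - b) - (r : ℝ) ^ 2 / 2 ≤ x →
    b * ((t : ℝ) - r) - (b : ℝ) ^ 2 / 2 ≤ y →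
    Forces (Good t) m (t - (r + b) : ℕ) r b x y := by
  have ht' : (100000 : ℝ) ≤ t := by exact_mod_cast ht
  have hlow' : (t : ℝ) ≤ 4 * t₁ := by exact_mod_cast hlow
  have hupp' : 4 * (t₁ : ℝ) < t + 4 := by exact_mod_cast hupp
  induction j with
  | zero =>
    intro m r b x y hm hj hxy hx hy
    have hj' : (r : ℝ) + b = t₁ := by exact_mod_cast hj
    have hm' : (t : ℝ) ≤ m := by exact_mod_cast hm
    have hr0 : (0 : ℝ) ≤ r := Nat.cast_nonneg _
    have hb0 : (0 : ℝ) ≤ b := Nat.cast_nonneg _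
    have hs : ((t - (r + b) : ℕ) : ℝ) = t - r - b := by
      rw [Nat.cast_sub (by omega)]; push_cast; ring
    by_cases hr : (r : ℝ) < 7 / 100 * t
    · have := forces_biased ht hs (by linarith) (by linarith) hr hxy hx hy m (t - (r + b) : ℕ) 0 0 0 0
        (by linarith) (by simp) (by linarith) (by push_cast; linarith) (by push_cast; linarith)
        (by simp) (by simp) (by simp)
      simpa using this
    by_cases hb : (b : ℝ) < 7 / 100 * t
    · have hs' : ((t - (r + b) : ℕ) : ℝ) = t - b - r := by rw [hs]; ring
      have := forces_biased ht hs' (by linarith) (by linarith) hb (by linarith) hy hx m (t - (r + b) : ℕ) 0 0 0 0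
        (by linarith) (by simp) (by linarith) (by push_cast; linarith) (by push_cast; linarith)
        (by simp) (by simp) (by simp)
      have := this.swap
      simp only [good_comm (t := (t : ℝ))] at this
      simpa using this
    push Not at hr hb
    refine forces_bisection ht _ _ _ _ _ _ (by omega) (by omega) hr (by linarith) hb (by linarith)
      hxy ?_ ?_
    all_goals nlinarith
  | succ j ih =>
    intro m r b x y hm hj hxy hx hy
    obtain ⟨m, rfl⟩ : ∃ m', m = m' + 1 := ⟨m - 1, by omega⟩
    have hs : ((t - (r + b) : ℕ) : ℝ) = t - r - b := by
      rw [Nat.cast_sub (by omega)]; push_cast; ring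
    have hb0 : (0 : ℝ) ≤ b := Nat.cast_nonneg _
    have hr0 : (0 : ℝ) ≤ r := Nat.cast_nonneg _
    have hk : t - (r + b) = (t - (r + b) - 1) + 1 := by omega
    have hk₀ : t - (r + 1 + b) = t - (r + b) - 1 := by omega
    have hk₁ : t - (r + (b + 1)) = t - (r + b) - 1 := by omega
    have hk' : ((t - (r + b) - 1 : ℕ) : ℝ) = t - r - b - 1 := by
      rw [Nat.cast_sub (by omega), hs]; push_cast; ring
    have hsplit := splits_bisect (t - (r + b) - 1)
    rw [← hk] at hsplit
    refine .step hsplit (hk₀ ▸ ih _ _ _ _ _ (by omega) (by omega) ?_ ?_ ?_)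
      (hk₁ ▸ ih _ _ _ _ _ (by omega) (by omega) ?_ ?_ ?_)
    all_goals simp only [hk₀, hk₁, hk', hs] at hxy ⊢
    all_goals push_cast
    all_goals linarith

theorem forces_good {t : ℕ} (ht : 100000 ≤ t) : Forces (Good t) (2 * t) t 0 0 0 0 := by
  have := forces_first_phase (t₁ := (t + 3) / 4) ht (by omega) (by omega) ((t + 3) / 4) (2 * t) 0 0
    0 0 (by omega) (by omega) (by simp) (by simp) (by simp)
  simpa using this

/-! ### Counting monochromatic cliques -/

theorem orderedCliques_le_mul_monoCliqueCount {V : Type*} [Fintype V]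
    (C : SimpleGraph.TopEdgeLabeling V (Fin 2)) (c : Fin 2) {a b : ℝ} {k : ℕ} (ha : a < k)
    (hb : (k : ℝ) < b) :
    orderedCliques (C.labelGraph c) univ k ≤ k.factorial * monoCliqueCount C a b := by
  classical
  unfold orderedCliques monoCliqueCount
  gcongr
  rw [← Set.ncard_coe_finset]
  refine Set.ncard_le_ncard ?_ (Set.toFinite _)
  intro K hK
  simp only [coe_filter, mem_powersetCard, subset_univ, true_and, Set.mem_ofPred_eq] at hK ⊢
  exact ⟨⟨c, hK.2⟩, by rwa [hK.1], by rwa [hK.1]⟩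

theorem eventually_le_two_rpow {δ : ℝ} (hδ : 0 < δ) :
    ∀ᶠ t : ℕ in Filter.atTop, (t : ℝ) ≤ 2 ^ (δ * t) := by
  have h := (tendsto_pow_const_div_const_pow_of_one_lt 1
    (Real.one_lt_rpow one_lt_two hδ)).eventually_lt_const one_pos
  filter_upwards [h] with t ht
  rw [div_lt_one (by positivity), pow_one] at ht
  rw [Real.rpow_mul two_pos.le, Real.rpow_natCast]
  exact ht.le

/-- The count for `2 ^ t` vertices, with a margin `1` in the lower bound for the sizes that absorbs
the rounding of `logb 2 n`. -/
theorem exists_forall_two_rpow_le_monoCliqueCount {ε : ℝ} (hε : 0 < ε) :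
    ∃ T : ℕ, ∀ t : ℕ, T ≤ t → ∀ (V : Type*) [Fintype V], 2 ^ t ≤ Fintype.card V →
      ∀ C : SimpleGraph.TopEdgeLabeling V (Fin 2),
        (2 : ℝ) ^ ((1 / 4 - ε) * (t : ℝ) ^ 2)
          ≤ monoCliqueCount C (0.3 * (t : ℝ) + 1) (0.7 * (t : ℝ)) := by
  obtain ⟨T, hT⟩ := Filter.eventually_atTop.1 ((eventually_le_two_rpow (half_pos hε)).and
    ((Filter.eventually_ge_atTop 100000).and
      (tendsto_natCast_atTop_atTop.eventually_ge_atTop (6 / ε))))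
  refine ⟨T, fun t ht V _ hV C => ?_⟩
  obtain ⟨h₁, h₂, h₃⟩ := hT t ht
  rw [div_le_iff₀ hε] at h₃
  -- `x` is the weight of the color `c`, and `2 t` bounds the number of steps
  have key (c : Fin 2) (k : ℕ) (x : ℝ) (hk : 3 / 10 * (t : ℝ) + 1 < k)
      (hk' : (k : ℝ) < 7 / 10 * t) (hx : (t : ℝ) ^ 2 / 4 - t ≤ x)
      (hcount : (2 : ℝ) ^ (x - (2 * t : ℕ)) ≤ orderedCliques (C.labelGraph c) univ k) :
      (2 : ℝ) ^ ((1 / 4 - ε) * (t : ℝ) ^ 2)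
        ≤ monoCliqueCount C (0.3 * (t : ℝ) + 1) (0.7 * (t : ℝ)) := by
    have ha : 0.3 * (t : ℝ) + 1 < k := by norm_num; exact hk
    have hb : (k : ℝ) < 0.7 * t := by norm_num; exact hk'
    have hkt : k ≤ t := by
      have : (k : ℝ) ≤ t := by linarith
      exact_mod_cast this
    have hfac : (k.factorial : ℝ) ≤ 2 ^ (ε / 2 * (t : ℝ) ^ 2) := by
      calc (k.factorial : ℝ) ≤ (t.factorial : ℝ) := by exact_mod_cast Nat.factorial_le hkt
        _ ≤ (t : ℝ) ^ t := by exact_mod_cast Nat.factorial_le_pow t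
        _ ≤ ((2 : ℝ) ^ (ε / 2 * t)) ^ t := by gcongr
        _ = _ := by rw [← Real.rpow_natCast, ← Real.rpow_mul two_pos.le]; congr 1; ring
    have hle : (2 : ℝ) ^ (ε / 2 * (t : ℝ) ^ 2) * 2 ^ ((1 / 4 - ε) * (t : ℝ) ^ 2)
        ≤ 2 ^ (ε / 2 * (t : ℝ) ^ 2) * monoCliqueCount C (0.3 * (t : ℝ) + 1) (0.7 * (t : ℝ)) := by
      calc _ = (2 : ℝ) ^ (ε / 2 * (t : ℝ) ^ 2 + (1 / 4 - ε) * (t : ℝ) ^ 2) :=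
            (Real.rpow_add two_pos _ _).symm
        _ ≤ 2 ^ (x - (2 * t : ℕ)) := by
            refine Real.rpow_le_rpow_of_exponent_le one_le_two ?_
            push_cast
            nlinarith [mul_le_mul_of_nonneg_left h₃ (Nat.cast_nonneg (α := ℝ) t)]
        _ ≤ _ := hcount
        _ ≤ ((k.factorial * monoCliqueCount C (0.3 * (t : ℝ) + 1) (0.7 * (t : ℝ)) : ℕ) : ℝ) := by
            exact_mod_cast orderedCliques_le_mul_monoCliqueCount C c ha hb
        _ ≤ _ := by push_cast; gcongr
    exact le_of_mul_le_mul_left hle (by positivity)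
  have hcover : ∀ v w, v ≠ w → (C.labelGraph 0).Adj v w ∨ (C.labelGraph 1).Adj v w := by
    intro v w hvw
    simp only [SimpleGraph.TopEdgeLabeling.labelGraph_adj, hvw, ne_eq, not_false_eq_true,
      exists_true_left]
    exact Fin.exists_fin_two.1 ⟨_, rfl⟩
  obtain ⟨r, b, x, y, hgood, hr, hb⟩ := (forces_good h₂).exists_outcome hcover (A := univ) (by
    rw [Real.rpow_natCast, card_univ]; exact_mod_cast hV)
  rcases hgood with h | h
  · exact key 0 r x h.1 h.2.1 h.2.2 hr
  · exact key 1 b y h.1 h.2.1 h.2.2 hb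

theorem monoCliqueCount_mono {V : Type*} [Fintype V] (C : SimpleGraph.TopEdgeLabeling V (Fin 2))
    {a b a' b' : ℝ} (ha : a' ≤ a) (hb : b ≤ b') :
    monoCliqueCount C a b ≤ monoCliqueCount C a' b' :=
  Set.ncard_le_ncard (fun _ h => ⟨h.1, ha.trans_lt h.2.1, h.2.2.trans_le hb⟩) (Set.toFinite _)

theorem theorem1 :
    (∀ ε : ℝ, 0 < ε → ∃ T : ℕ, ∀ t : ℕ, T ≤ t →
      ∀ (V : Type*) [Fintype V], Fintype.card V = 2 ^ t →
        ∀ C : SimpleGraph.TopEdgeLabeling V (Fin 2),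
          (2 : ℝ) ^ ((1 / 4 - ε) * (t : ℝ) ^ 2)
            ≤ (monoCliqueCount C (0.3 * (t : ℝ)) (0.7 * (t : ℝ)) : ℝ)) ∧
    (∀ ε : ℝ, 0 < ε → ∃ N : ℕ, ∀ n : ℕ, N ≤ n →
      ∀ (V : Type*) [Fintype V], Fintype.card V = n →
        ∀ C : SimpleGraph.TopEdgeLabeling V (Fin 2),
          (n : ℝ) ^ ((1 / 4 - ε) * Real.logb 2 (n : ℝ))
            ≤ (monoCliqueCount C (0.3 * Real.logb 2 (n : ℝ)) (0.7 * Real.logb 2 (n : ℝ)) : ℝ)) := by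
  refine ⟨fun ε hε => ?_, fun ε hε => ?_⟩
  · obtain ⟨T, hT⟩ := exists_forall_two_rpow_le_monoCliqueCount hε
    refine ⟨T, fun t ht V _ hV C => (hT t ht V hV.ge C).trans ?_⟩
    exact_mod_cast monoCliqueCount_mono C (by linarith) le_rfl
  · obtain ⟨T, hT⟩ := exists_forall_two_rpow_le_monoCliqueCount (half_pos hε)
    obtain ⟨T', hT'⟩ := exists_nat_ge (2 / ε)
    rw [div_le_iff₀ hε] at hT'
    refine ⟨2 ^ (T + T' + 1), fun n hn V _ hV C => ?_⟩
    -- `2 ^ t ≤ n < 2 ^ (t + 1)`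
    set t := Nat.log 2 n with ht
    have hn0 : n ≠ 0 := by
      rintro rfl
      simp at hn
    have hn' : (0 : ℝ) < n := by positivity
    have htT : T + T' + 1 ≤ t := Nat.le_log_of_pow_le one_lt_two hn
    have hlow : (t : ℝ) ≤ Real.logb 2 n := by
      rw [Real.le_logb_iff_rpow_le one_lt_two hn', Real.rpow_natCast]
      exact_mod_cast Nat.pow_log_le_self 2 hn0
    have hupp : Real.logb 2 n < t + 1 := by
      rw [Real.logb_lt_iff_lt_rpow one_lt_two hn']
      exact_mod_cast Nat.lt_pow_succ_log_self one_lt_two n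
    have ht' : (T' : ℝ) + 1 ≤ t := by
      have : T' + 1 ≤ t := by omega
      exact_mod_cast this
    have hsize := hT t (by omega) V (hV ▸ Nat.pow_log_le_self 2 hn0) C
    set l := Real.logb 2 (n : ℝ) with hl
    have hl0 : 0 ≤ (t : ℝ) := Nat.cast_nonneg _
    have hnl : (n : ℝ) = 2 ^ l := (Real.rpow_logb two_pos (by norm_num) hn').symm
    calc (n : ℝ) ^ ((1 / 4 - ε) * l) = 2 ^ ((1 / 4 - ε) * l ^ 2) := by
          rw [hnl, ← Real.rpow_mul two_pos.le]; congr 1; ring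
      _ ≤ 2 ^ ((1 / 4 - ε / 2) * (t : ℝ) ^ 2) := by
          refine Real.rpow_le_rpow_of_exponent_le one_le_two ?_
          have hεt : 2 ≤ t * ε := hT'.trans (by gcongr; linarith)
          by_cases h : ε ≤ 1 / 4
          · have h1 : l ^ 2 ≤ (t + 1) ^ 2 := pow_le_pow_left₀ (hl0.trans hlow) hupp.le 2
            have h2 : (1 / 4 - ε) * l ^ 2 ≤ (1 / 4 - ε) * (t + 1) ^ 2 := by
              exact mul_le_mul_of_nonneg_left h1 (by linarith)
            nlinarith [mul_le_mul_of_nonneg_left hεt hl0]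
          · have h1 : (t : ℝ) ^ 2 ≤ l ^ 2 := by gcongr
            nlinarith [sq_nonneg (t : ℝ)]
      _ ≤ monoCliqueCount C (0.3 * (t : ℝ) + 1) (0.7 * (t : ℝ)) := hsize
      _ ≤ _ := by
          exact_mod_cast monoCliqueCount_mono C (by linarith) (by linarith)
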